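/- Let $d\in\mathbb{N}$ and equip $\mathbb{R}^d$ with the Euclidean norm. For $A\subset\mathbb{R}^d$ let $d_A(x)=\inf_{a\in A}\|x-a\|$ be the distance function to $A$, and let ${}^{\neg}A=\overline{\mathbb{R}^d\setminus A}$. For a locally Lipschitz function $\phi:\mathbb{R}^d\to\mathbb{R}$, the Clarke gradient $\partial^*\phi(x)$ is the convex hull of all limits $\lim_n\nabla\phi(x_n)$ with $x_n\to x$ and $\phi$ differentiable at every $x_n$. For $S\subset\mathbb{R}^d$ put $\Delta(S)=\inf\{\|v\| : v\in S\}$. For $\mu\in(0,1]$ let $$\mathrm{reach}_\mu(A)=\sup\{s : \text{for all } x,\ 0<d_A(x)\le s \implies \Delta(\partial^*d_A(x))\ge\mu\},$$ and let $\mathrm{reach}(A)$ be the supremum of the $t$ such that every $x$ with $d_A(x)<t$ has a unique closest point in $A$ (by convention $d_\emptyset=+\infty$ and $\mathrm{reach}(\emptyset)=+\infty$ here). A compact set $X\subset\mathbb{R}^d$ is called *complementary regular* if $\overline{\mathrm{int}(X)}=X$, $\mathrm{reach}_\mu(X)>0$ for some $\mu\in(0,1]$, and $\mathrm{reach}({}^{\neg}X)>0$.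 The tangent cone $\mathrm{Tan}(A,x)$ is the cone generated by the limits of $\frac{x_n-x}{\|x_n-x\|}$ with $x_n\in A\setminus\{x\}$, $x_n\to x$. For $X$ complementary regular and $x\in X$, let $\mathrm{Nor}(X,x)=-\{u : \langle u,v\rangle\le 0\ \ \forall v\in\mathrm{Tan}({}^{\neg}X,x)\}$ if $x\in\partial X$, and $\mathrm{Nor}(X,x)=\{0\}$ if $x\in\mathrm{int}(X)$. For $f:\mathbb{R}^d\to\mathbb{R}$ of class $C^2$, a point $x\in X$ is a critical point of $f_{|X}$ if $\nabla f(x)\in-\mathrm{Nor}(X,x)$, and $c\in\mathbb{R}$ is a regular value of $f_{|X}$ if no critical point $x$ of $f_{|X}$ satisfies $f(x)=c$. Write $X_c=X\cap f^{-1}(-\infty,c]$. **Theorem (constant homotopy type between critical values).** Let $X\subset\mathbb{R}^d$ be complementary regular, let $f:\mathbb{R}^d\to\mathbb{R}$ be of class $C^2$, and let $a<b$ be real numbers such that every $c\in[a,b]$ is a regular value of $f_{|X}$. Then $X_a$ is a deformation retract of $X_b$: there is a continuous map $H:[0,1]\times X_b\to X_b$ with $H(0,x)=x$ and $H(1,x)\in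 X_a$ for all $x\in X_b$, and $H(t,x)=x$ for all $x\in X_a$ and $t\in[0,1]$. -/

import Mathlib

open Set Filter Topology
open scoped ENNReal unitInterval

noncomputable section

/-- The Euclidean space `ℝᵈ`. -/
abbrev Euc (d : ℕ) : Type := EuclideanSpace ℝ (Fin d)

/-- The complement set of `X`, i.e. the closure of its set-theoretic complement. -/
def complementSet {d : ℕ} (X : Set (Euc d)) : Set (Euc d) := closure Xᶜ

/-- The distance function `d_X` to the set `X`. -/
def distFun {d : ℕ} (X : Set (Euc d)) : Euc d → ℝ := fun x => Metric.infDist x X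

/-- The Clarke gradient of `φ` at `x`: the convex hull of the limits of the gradients of `φ`
at differentiability points converging to `x`. -/
def clarkeGradient {d : ℕ} (φ : Euc d → ℝ) (x : Euc d) : Set (Euc d) :=
  convexHull ℝ {v | ∃ u : ℕ → Euc d, Tendsto u atTop (𝓝 x) ∧
    (∀ n, DifferentiableAt ℝ φ (u n)) ∧
    Tendsto (fun n => gradient φ (u n)) atTop (𝓝 v)}

/-- `Δ(S)`, the infimum of the norms of the elements of `S`, i.e. the distance from `0` to `S`. -/
def minNorm {d : ℕ} (S : Set (Euc d)) : ℝ := Metric.infDist 0 S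

/-- The `μ`-reach of `X`: the supremum of the `s` such that the Clarke gradient of `d_X` stays at
distance at least `μ` from `0` at all points `x` with `0 < d_X(x) ≤ s`. -/
def muReach {d : ℕ} (μ : ℝ) (X : Set (Euc d)) : ℝ≥0∞ :=
  sSup {s : ℝ≥0∞ | ∀ x : Euc d, 0 < Metric.infEDist x X → Metric.infEDist x X ≤ s →
    μ ≤ minNorm (clarkeGradient (distFun X) x)}

/-- The reach of `A`: the supremum of the `t` such that every point at distance less than `t` from
`A` has a unique closest point in `A` (the reach of the empty set is infinite). -/
def reach {d : ℕ} (A : Set (Euc d)) : ℝ≥0∞ :=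
  sSup {t : ℝ≥0∞ | ∀ x : Euc d, Metric.infEDist x A < t →
    ∃! z, z ∈ A ∧ edist x z = Metric.infEDist x A}

/-- Complementary regular sets. -/
structure IsComplementaryRegular {d : ℕ} (X : Set (Euc d)) : Prop where
  isCompact : IsCompact X
  closure_interior : closure (interior X) = X
  muReach_pos : ∃ μ : ℝ, 0 < μ ∧ μ ≤ 1 ∧ 0 < muReach μ X
  reach_complementSet_pos : 0 < reach (complementSet X)

/-- The tangent cone of `A` at `x`: the cone generated by the limits of
`(xₙ - x) / ‖xₙ - x‖`, where `xₙ ∈ A \ {x}` converges to `x`. -/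
def tanCone {d : ℕ} (A : Set (Euc d)) (x : Euc d) : Set (Euc d) :=
  {v | ∃ (l : ℝ) (w : Euc d), 0 ≤ l ∧ v = l • w ∧
    ∃ u : ℕ → Euc d, (∀ n, u n ∈ A ∧ u n ≠ x) ∧ Tendsto u atTop (𝓝 x) ∧
      Tendsto (fun n => ‖u n - x‖⁻¹ • (u n - x)) atTop (𝓝 w)}

/-- The polar cone of `B`. -/
def polarCone {d : ℕ} (B : Set (Euc d)) : Set (Euc d) :=
  {u | ∀ b ∈ B, inner ℝ u b ≤ 0}

/-- The normal cone at a point `x ∈ X`, for a set `X` whose complement set has positive reach: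
the opposite of the polar of the tangent cone of the complement set when `x` is a boundary point,
and `{0}` when `x` is an interior point. -/
def norCone {d : ℕ} (X : Set (Euc d)) (x : Euc d) : Set (Euc d) :=
  {n | (x ∈ frontier X → -n ∈ polarCone (tanCone (complementSet X) x)) ∧
    (x ∉ frontier X → n = 0)}

/-- `x` is a critical point of `f|_X`: `x ∈ X` and `∇f(x) ∈ -Nor(X, x)`. -/
def IsCriticalPointOn {d : ℕ} (f : Euc d → ℝ) (X : Set (Euc d)) (x : Euc d) : Prop :=
  x ∈ X ∧ -gradient f x ∈ norCone X x

/-- `c` is a regular value of `f|_X`: no critical point of `f|_X` has value `c`. -/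
def IsRegularValueOn {d : ℕ} (f : Euc d → ℝ) (X : Set (Euc d)) (c : ℝ) : Prop :=
  ¬ ∃ x, IsCriticalPointOn f X x ∧ f x = c

/-- The sublevel set `X_c = X ∩ f⁻¹(-∞, c]`. -/
def sublevelOn {d : ℕ} (f : Euc d → ℝ) (X : Set (Euc d)) (c : ℝ) : Set (Euc d) :=
  X ∩ f ⁻¹' Iic c

/-- `A` is a (strong) deformation retract of `B`: `A ⊆ B`, and the identity of `B` is homotopic,
relatively to `A`, to a continuous map of `B` into itself with values in `A`. -/
def IsDeformationRetract {Y : Type*} [TopologicalSpace Y] (A B : Set Y) : Prop :=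
  A ⊆ B ∧ ∃ r : C(B, B), (∀ y, (r y : Y) ∈ A) ∧
    ContinuousMap.HomotopicRel (ContinuousMap.id B) r {y : B | (y : Y) ∈ A}

end

/-!
Let `C` be the complement set of `X`. Since `C` has positive reach, its normals at `x` are the unit
vectors `n` for which the ball of a fixed radius `r` centred at `x + r • n` avoids `C`; they form a
compact set depending upper hemicontinuously on `x`. If no vector `v` had positive inner product
with all normals at `x`, every `z` would lie on the nonnegative side of some normal `n` at `x`, and
the ball in `X` attached to `n` would give `d_X z = O(‖z - x‖ ^ 2)`. This contradicts the positive
`μ`-reach of `X`: climbing `d_X` at slope `μ` from points outside `X` close to `x` shows that `d_X`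
grows linearly near `x`. So strictly inward directions exist, and where `f` is regular one of them
decreases `f`. These are convex open conditions, hence a partition of unity yields a vector field
which points into `X` and decreases `f` at speed at least one on `X ∩ f ⁻¹' [a, b]`; its flow is
the deformation.
-/

section NearestPoints

/-- The metric projection of `z` onto `A`, as a set: the points of `A` closest to `z`. -/
def nearestPoints {α : Type*} [PseudoMetricSpace α] (A : Set α) (z : α) : Set α :=
  {p | p ∈ A ∧ dist z p = Metric.infDist z A}

/-- `A` has reach at least `r`. Only uniqueness of nearest points is recorded, because their
existence is automatic for closed sets in proper spaces. -/
def HasReachAtLeast {α : Type*} [PseudoMetricSpace α] (A : Set α) (r : ℝ) : Prop :=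
  ∀ z, Metric.infDist z A < r → (nearestPoints A z).Subsingleton

theorem nearestPoints_nonempty {α : Type*} [PseudoMetricSpace α] [ProperSpace α] {A : Set α}
    (hA : IsClosed A) (hne : A.Nonempty) (z : α) : (nearestPoints A z).Nonempty :=
  let ⟨p, hp, hzp⟩ := hA.exists_infDist_eq_dist hne z
  ⟨p, hp, hzp.symm⟩

theorem norm_sub_eq_infDist {E : Type*} [SeminormedAddCommGroup E] {A : Set E} {z p : E}
    (hp : p ∈ nearestPoints A z) : ‖z - p‖ = Metric.infDist z A := by
  rw [← dist_eq_norm, hp.2]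

theorem nonempty_of_infDist_pos {α : Type*} [PseudoMetricSpace α] {A : Set α} {z : α}
    (hz : 0 < Metric.infDist z A) : A.Nonempty :=
  nonempty_iff_ne_empty.2 fun h => by simp [h] at hz

theorem exists_forall_mem_of_nearestPoints_subset {α : Type*} [PseudoMetricSpace α]
    [ProperSpace α] {A U : Set α} (hA : IsClosed A) (hU : IsOpen U) {z : α}
    (h : nearestPoints A z ⊆ U) :
    ∃ ε > 0, ∀ p ∈ A, dist z p < Metric.infDist z A + ε → p ∈ U := by
  rcases (A ∩ Uᶜ).eq_empty_or_nonempty with hempty | hne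
  · exact ⟨1, one_pos, fun p hp _ => sdiff_eq_empty.1 hempty hp⟩
  · obtain ⟨q, ⟨hqA, hqU⟩, hq⟩ := nearestPoints_nonempty (hA.inter hU.isClosed_compl) hne z
    have hlt : Metric.infDist z A < dist z q :=
      (Metric.infDist_le_dist_of_mem hqA).lt_of_ne fun heq => hqU (h ⟨hqA, heq.symm⟩)
    refine ⟨dist z q - Metric.infDist z A, sub_pos.2 hlt, fun p hpA hp => ?_⟩
    by_contra hpU
    have : dist z q ≤ dist z p := hq ▸ Metric.infDist_le_dist_of_mem ⟨hpA, hpU⟩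
    linarith

end NearestPoints

section Ascent

variable {Y : Type*} [PseudoMetricSpace Y] [ProperSpace Y]

theorem exists_dist_eq_add_mul_le_of_frequently {g : Y → ℝ} (hg : Continuous g) {y : Y} {t m : ℝ}
    (ht : 0 ≤ t) (hm : 0 ≤ m)
    (hasc : ∀ z, dist z y < t → g y ≤ g z → ∃ᶠ z' in 𝓝 z, g z + m * dist z' z < g z') :
    ∃ z, dist z y = t ∧ g y + m * t ≤ g z := by
  -- The maximum of the penalized function cannot be attained in the open ball.
  obtain ⟨z, hz, hmax⟩ := (isCompact_closedBall y t).exists_isMaxOn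
    (f := fun z => g z - m * dist z y) ⟨y, Metric.mem_closedBall_self ht⟩ (by fun_prop)
  have hgz : g y ≤ g z - m * dist z y := by
    simpa using hmax (Metric.mem_closedBall_self ht)
  suffices hzt : dist z y = t from ⟨z, hzt, by rw [← hzt]; linarith⟩
  refine le_antisymm hz (not_lt.1 fun hlt => ?_)
  have hnear : ∀ᶠ z' in 𝓝 z, dist z' y ≤ t :=
    Eventually.mono (Metric.isOpen_ball.mem_nhds hlt) fun _ hz' => (Metric.mem_ball.1 hz').le
  obtain ⟨z', hgz', hz't⟩ := ((hasc z hlt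
    (by linarith [mul_nonneg hm (dist_nonneg (x := z) (y := y))])).and_eventually hnear).exists
  have hle : g z' - m * dist z' y ≤ g z - m * dist z y := hmax hz't
  linarith [mul_le_mul_of_nonneg_left (dist_triangle z' z y) hm]

theorem exists_dist_eq_add_mul_le_of_forall_lt {g : Y → ℝ} (hg : Continuous g) {y : Y} {t μ : ℝ}
    (ht : 0 ≤ t) (hμ : 0 < μ)
    (hasc : ∀ m, 0 ≤ m → m < μ → ∀ z, dist z y < t → g y ≤ g z →
      ∃ᶠ z' in 𝓝 z, g z + m * dist z' z < g z') :
    ∃ z, dist z y = t ∧ g y + μ * t ≤ g z := by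
  have hslope : ∀ m, 0 ≤ m → m < μ → ∃ z, dist z y = t ∧ g y + m * t ≤ g z :=
    fun m hm hmμ => exists_dist_eq_add_mul_le_of_frequently hg ht hm (hasc m hm hmμ)
  have hsphere : (Metric.sphere y t).Nonempty := (hslope 0 le_rfl hμ).imp fun _ hz => hz.1
  obtain ⟨z, hz, hmax⟩ := (isCompact_sphere y t).exists_isMaxOn hsphere hg.continuousOn
  refine ⟨z, hz, ?_⟩
  have hlim : Tendsto (fun m => g y + m * t) (𝓝[<] μ) (𝓝 (g y + μ * t)) :=
    (Continuous.tendsto (by fun_prop) μ).mono_left nhdsWithin_le_nhds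
  refine le_of_tendsto hlim ?_
  filter_upwards [Ioo_mem_nhdsLT hμ] with m hm
  obtain ⟨w, hw, hgw⟩ := hslope m hm.1.le hm.2
  exact hgw.trans (hmax hw)

variable {E : Type*} [NormedAddCommGroup E] [InnerProductSpace ℝ E] [ProperSpace E]

theorem eventually_infDist_add_mul_lt {A : Set E} (hA : IsClosed A) (hne : A.Nonempty) {z v : E}
    {m : ℝ} (hv : ‖v‖ = 1) (hm : 0 ≤ m)
    (h : ∀ p ∈ nearestPoints A z, m * Metric.infDist z A < inner ℝ v (z - p)) :
    ∀ᶠ s in 𝓝[>] (0 : ℝ), Metric.infDist z A + m * s < Metric.infDist (z + s • v) A := by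
  set d := Metric.infDist z A
  have hd : 0 ≤ d := Metric.infDist_nonneg
  have hm1 : m < 1 := by
    obtain ⟨p, hp⟩ := nearestPoints_nonempty hA hne z
    have hcs : inner ℝ v (z - p) ≤ d := by
      simpa [hv, norm_sub_eq_infDist hp] using real_inner_le_norm v (z - p)
    nlinarith [h p hp]
  obtain ⟨ε, hε, hε_inner⟩ := exists_forall_mem_of_nearestPoints_subset hA
    (isOpen_lt (f := fun _ => m * d) (g := fun p => inner ℝ v (z - p))
      (by fun_prop) (by fun_prop)) h
  filter_upwards [Ioo_mem_nhdsGT (half_pos hε)] with s ⟨hs0, hsε⟩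
  obtain ⟨p, hpA, hp⟩ := nearestPoints_nonempty hA hne (z + s • v)
  have hstep : dist (z + s • v) z = s := by simp [dist_eq_norm, norm_smul, hv, hs0.le]
  have hnear : dist z p < d + ε := by
    have hupper := Metric.infDist_le_infDist_add_dist (s := A) (x := z + s • v) (y := z)
    have htri := dist_triangle_left z p (z + s • v)
    linarith
  have hinner : m * d < inner ℝ v (z - p) := hε_inner p hpA hnear
  have hdp : d ≤ ‖z - p‖ := dist_eq_norm z p ▸ Metric.infDist_le_dist_of_mem hpA
  have hexpand : dist (z + s • v) p ^ 2 = ‖z - p‖ ^ 2 + 2 * s * inner ℝ v (z - p) + s ^ 2 := by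
    rw [dist_eq_norm, add_sub_right_comm, norm_add_sq_real, norm_smul, hv, inner_smul_right,
      real_inner_comm, Real.norm_of_nonneg hs0.le]
    ring
  rw [← hp]
  refine lt_of_pow_lt_pow_left₀ 2 dist_nonneg ?_
  calc (d + m * s) ^ 2 = d ^ 2 + 2 * s * (m * d) + (m * s) ^ 2 := by ring
    _ < ‖z - p‖ ^ 2 + 2 * s * inner ℝ v (z - p) + s ^ 2 := by
      have hsq : (m * s) ^ 2 ≤ s ^ 2 := by gcongr; exact mul_le_of_le_one_left hs0.le hm1.le
      have hdsq : d ^ 2 ≤ ‖z - p‖ ^ 2 := by gcongr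
      linarith [mul_lt_mul_of_pos_left hinner (mul_pos two_pos hs0)]
    _ = dist (z + s • v) p ^ 2 := hexpand.symm

/-- This replaces following the gradient flow of the distance to `A`, which need not exist. -/
theorem exists_dist_eq_add_mul_le_infDist {A : Set E} (hA : IsClosed A) {y : E} {t μ : ℝ}
    (ht : 0 ≤ t) (hμ : 0 < μ) (hy : 0 < Metric.infDist y A)
    (hdir : ∀ z, dist z y < t → 0 < Metric.infDist z A →
      ∃ v, ‖v‖ = 1 ∧ ∀ p ∈ nearestPoints A z, μ * Metric.infDist z A ≤ inner ℝ v (z - p)) :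
    ∃ z, dist z y = t ∧ Metric.infDist y A + μ * t ≤ Metric.infDist z A := by
  refine exists_dist_eq_add_mul_le_of_forall_lt (Metric.continuous_infDist_pt A) ht hμ
    fun m hm hmμ z hzy hyz => ?_
  have hz : 0 < Metric.infDist z A := hy.trans_le hyz
  obtain ⟨v, hv, hvp⟩ := hdir z hzy hz
  have hray : Tendsto (fun s : ℝ => z + s • v) (𝓝[>] 0) (𝓝 z) :=
    (Continuous.tendsto' (by fun_prop) _ _ (by simp)).mono_left nhdsWithin_le_nhds
  refine hray.frequently (Eventually.frequently ?_)
  filter_upwards [eventually_infDist_add_mul_lt hA (nonempty_of_infDist_pos hy) hv hm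
    fun p hp => (mul_lt_mul_of_pos_right hmμ hz).trans_le (hvp p hp), self_mem_nhdsWithin]
    with s hs hs0
  simpa [dist_eq_norm, norm_smul, hv, abs_of_pos (mem_Ioi.1 hs0)] using hs

end Ascent

section UnitNormals

variable {E : Type*} [NormedAddCommGroup E] [NormedSpace ℝ E]

/-- The unit normals of radius `r` to `C` at `x ∈ C`: the unit vectors `n` such that the open ball
of radius `r` centred at `x + r • n` does not meet `C`. For `C` of reach greater than `r` these are
all the unit normals, and having a fixed radius makes their graph closed. -/
def unitNormals (C : Set E) (r : ℝ) (x : E) : Set E :=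
  {n | x ∈ C ∧ ‖n‖ = 1 ∧ r ≤ Metric.infDist (x + r • n) C}

theorem isClosed_setOf_mem_unitNormals {C : Set E} (hC : IsClosed C) (r : ℝ) :
    IsClosed {q : E × E | q.2 ∈ unitNormals C r q.1} :=
  (hC.preimage continuous_fst).inter <| (isClosed_eq (by fun_prop) continuous_const).inter <|
    isClosed_le continuous_const ((Metric.continuous_infDist_pt C).comp (by fun_prop))

theorem isCompact_unitNormals [ProperSpace E] {C : Set E} (hC : IsClosed C) (r : ℝ) (x : E) :
    IsCompact (unitNormals C r x) :=
  (isCompact_sphere (0 : E) 1).of_isClosed_subset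
    ((isClosed_setOf_mem_unitNormals hC r).preimage (f := fun n => (x, n)) (by fun_prop))
    fun _ hn => mem_sphere_zero_iff_norm.2 hn.2.1

theorem upperHemicontinuous_unitNormals [ProperSpace E] {C : Set E} (hC : IsClosed C) (r : ℝ) :
    UpperHemicontinuous (unitNormals C r) := by
  rw [upperHemicontinuous_iff]
  exact fun x => .of_sequences (isCompact_sphere (0 : E) 1).isSeqCompact
    (.of_forall fun _ _ hn => mem_sphere_zero_iff_norm.2 hn.2.1)
    fun _ hx _ hn _ hn₀ => (isClosed_setOf_mem_unitNormals hC r).mem_of_tendsto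
      (hx.prodMk_nhds hn₀) (.of_forall hn)

theorem ball_subset_of_mem_unitNormals_closure_compl {X : Set E} {r : ℝ} {x n : E}
    (hn : n ∈ unitNormals (closure Xᶜ) r x) : Metric.ball (x + r • n) r ⊆ X := by
  have hle : r ≤ Metric.infDist (x + r • n) Xᶜ := Metric.infDist_closure.subst hn.2.2
  exact disjoint_compl_right_iff_subset.1
    (Metric.disjoint_ball_infDist.mono_left (Metric.ball_subset_ball hle))

section StrictConvex

variable [StrictConvexSpace ℝ E]

theorem normalize_sub_mem_unitNormals_of_dist_eq {A : Set E} {r : ℝ} {y z p : E}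
    (hp : p ∈ nearestPoints A y) (hy : 0 < Metric.infDist y A)
    (hzy : dist z y = r - Metric.infDist y A) (hz : r ≤ Metric.infDist z A) :
    NormedSpace.normalize (y - p) ∈ unitNormals A r p := by
  have hyp : ‖y - p‖ = Metric.infDist y A := norm_sub_eq_infDist hp
  have hyp_ne : y - p ≠ 0 := norm_pos_iff.1 (hyp ▸ hy)
  have hray : SameRay ℝ (z - y) (y - p) := by
    refine sameRay_iff_norm_add.2 ((norm_add_le _ _).antisymm ?_)
    rw [sub_add_sub_cancel, ← dist_eq_norm, hzy, hyp, sub_add_cancel, ← dist_eq_norm]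
    exact hz.trans (Metric.infDist_le_dist_of_mem hp.1)
  have hzn : p + r • NormedSpace.normalize (y - p) = z := by
    have hzy' : z - y = ‖z - y‖ • NormedSpace.normalize (y - p) := by
      rw [NormedSpace.normalize, smul_comm, hray.norm_smul_eq,
        inv_smul_smul₀ (norm_ne_zero_iff.2 hyp_ne)]
    calc p + r • NormedSpace.normalize (y - p)
        = p + (‖z - y‖ + ‖y - p‖) • NormedSpace.normalize (y - p) := by
          rw [← dist_eq_norm, hzy, hyp, sub_add_cancel]
      _ = p + ((z - y) + (y - p)) := by rw [add_smul, ← hzy', NormedSpace.norm_smul_normalize]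
      _ = z := by abel
  exact ⟨hp.1, NormedSpace.norm_normalize_eq_one_iff.2 hyp_ne, hzn ▸ hz⟩

theorem eq_neg_of_mem_unitNormals_of_closedBall_subset {C : Set E} {r ρ : ℝ} (hr : 0 < r)
    (hρ : 0 < ρ) {p n ν : E} (hν : ‖ν‖ = 1) (hn : n ∈ unitNormals C r p)
    (hball : Metric.closedBall (p + ρ • ν) ρ ⊆ C) : n = -ν := by
  obtain ⟨-, hn1, hn⟩ := hn
  have hdisj : Disjoint (Metric.ball (p + r • n) r) (Metric.closedBall (p + ρ • ν) ρ) :=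
    Metric.disjoint_ball_infDist.mono (Metric.ball_subset_ball hn) hball
  -- The centres are at distance at least `r + ρ`, which forces equality in the triangle inequality.
  have hdist : r + ρ ≤ ‖r • n + ρ • -ν‖ := by
    have := (disjoint_ball_closedBall_iff hr hρ.le).1 hdisj
    rwa [dist_add_left, dist_eq_norm, sub_eq_add_neg, ← smul_neg] at this
  have hnorm : ‖r • n‖ = r ∧ ‖ρ • -ν‖ = ρ := by
    simp [norm_smul, hn1, hν, abs_of_pos hr, abs_of_pos hρ]
  have hray_smul : SameRay ℝ (r • n) (ρ • -ν) :=
    sameRay_iff_norm_add.2 ((norm_add_le _ _).antisymm (by rwa [hnorm.1, hnorm.2]))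
  have hray : SameRay ℝ n (-ν) := by
    simpa [hr.ne', hρ.ne'] using
      (hray_smul.pos_smul_left (inv_pos.2 hr)).pos_smul_right (inv_pos.2 hρ)
  exact hray.eq_of_norm_eq (by rw [hn1, norm_neg, hν])

end StrictConvex

end UnitNormals

section UnitNormalsInner

variable {E : Type*} [NormedAddCommGroup E] [InnerProductSpace ℝ E]

theorem real_inner_normalize_self (u : E) : inner ℝ (NormedSpace.normalize u) u = ‖u‖ := by
  rw [NormedSpace.normalize, real_inner_smul_left, real_inner_self_eq_norm_mul_norm]
  rcases eq_or_ne u 0 with rfl | hu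
  · simp
  · exact inv_mul_cancel_left₀ (norm_ne_zero_iff.2 hu) _

theorem two_mul_inner_le_of_mem_unitNormals {C : Set E} {r : ℝ} (hr : 0 ≤ r) {x n c : E}
    (hn : n ∈ unitNormals C r x) (hc : c ∈ C) : 2 * r * inner ℝ n (c - x) ≤ ‖c - x‖ ^ 2 := by
  have hle : r ^ 2 ≤ ‖(c - x) - r • n‖ ^ 2 := by
    rw [sub_sub, ← dist_eq_norm']
    gcongr
    exact hn.2.2.trans (Metric.infDist_le_dist_of_mem hc)
  rw [norm_sub_sq_real, norm_smul, hn.2.1, inner_smul_right, real_inner_comm, mul_one,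
    Real.norm_eq_abs, sq_abs] at hle
  linarith

theorem two_mul_infDist_le_of_mem_unitNormals_closure_compl {X : Set E} {r : ℝ} (hr : 0 < r)
    {x n z : E} (hn : n ∈ unitNormals (closure Xᶜ) r x) (hz : 0 ≤ inner ℝ n (z - x)) :
    2 * r * Metric.infDist z X ≤ ‖z - x‖ ^ 2 := by
  rcases (Metric.infDist_nonneg (x := z) (s := X)).eq_or_lt with h0 | hpos
  · rw [← h0, mul_zero]; positivity
  have hdisj : Disjoint (Metric.ball z (Metric.infDist z X)) (Metric.ball (x + r • n) r) :=
    Metric.disjoint_ball_infDist.mono_right (ball_subset_of_mem_unitNormals_closure_compl hn)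
  have hdist : Metric.infDist z X + r ≤ ‖(z - x) - r • n‖ := by
    have := (disjoint_ball_ball_iff hpos hr).1 hdisj
    rwa [dist_eq_norm, ← sub_sub] at this
  have hsq : (Metric.infDist z X + r) ^ 2 ≤ ‖(z - x) - r • n‖ ^ 2 := by gcongr
  rw [norm_sub_sq_real, norm_smul, hn.2.1, inner_smul_right, real_inner_comm, mul_one,
    Real.norm_eq_abs, sq_abs] at hsq
  nlinarith [mul_nonneg hr.le hz, sq_nonneg (Metric.infDist z X)]

variable [ProperSpace E]

theorem normalize_sub_mem_unitNormals {A : Set E} (hA : IsClosed A) {r : ℝ}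
    (hreach : HasReachAtLeast A r) {y p : E} (hp : p ∈ nearestPoints A y)
    (hy : 0 < Metric.infDist y A) (hyr : Metric.infDist y A < r) :
    NormedSpace.normalize (y - p) ∈ unitNormals A r p := by
  -- Below distance `r` the distance increases with slope one away from the unique nearest point.
  obtain ⟨z, hzy, hz⟩ := exists_dist_eq_add_mul_le_infDist hA (sub_pos.2 hyr).le one_pos hy
    fun z hzy hz => by
      have hzr : Metric.infDist z A < r := by
        linarith [Metric.infDist_le_infDist_add_dist (s := A) (x := z) (y := y)]
      obtain ⟨q, hq⟩ := nearestPoints_nonempty hA ⟨p, hp.1⟩ z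
      have hzq : ‖z - q‖ = Metric.infDist z A := norm_sub_eq_infDist hq
      refine ⟨NormedSpace.normalize (z - q),
        NormedSpace.norm_normalize_eq_one_iff.2 (norm_pos_iff.1 (hzq ▸ hz)),
        fun q' hq' => ?_⟩
      rw [hreach z hzr hq' hq, real_inner_normalize_self, hzq, one_mul]
  exact normalize_sub_mem_unitNormals_of_dist_eq hp hy hzy (by linarith)

theorem unitNormals_nonempty {A : Set E} (hA : IsClosed A) {r : ℝ} (hr : 0 < r)
    (hreach : HasReachAtLeast A r) {x : E} (hx : x ∈ A) (hxc : x ∈ closure Aᶜ) :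
    (unitNormals A r x).Nonempty := by
  refine (upperHemicontinuous_unitNormals hA r).isClosed_domain.closure_eq.subset
    (Metric.mem_closure_iff.2 fun ε hε => ?_)
  obtain ⟨y, hyA, hxy⟩ := Metric.mem_closure_iff.1 hxc (min r (ε / 2)) (by positivity)
  obtain ⟨hxr, hxε⟩ := lt_min_iff.1 hxy
  obtain ⟨p, hp⟩ := nearestPoints_nonempty hA ⟨x, hx⟩ y
  have hyx : Metric.infDist y A ≤ dist x y := dist_comm x y ▸ Metric.infDist_le_dist_of_mem hx
  refine ⟨p, ⟨_, normalize_sub_mem_unitNormals hA hreach hp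
    ((hA.notMem_iff_infDist_pos ⟨x, hx⟩).1 hyA) (hyx.trans_lt hxr)⟩, ?_⟩
  have := dist_triangle x y p
  linarith [hp.2]

end UnitNormalsInner

section Separation

variable {E : Type*} [NormedAddCommGroup E] [InnerProductSpace ℝ E] [CompleteSpace E]

theorem exists_mem_closure_convexHull_norm_sq_le_inner {N : Set E} (hN : N.Nonempty) :
    ∃ v ∈ closure (convexHull ℝ N), ∀ n ∈ N, ‖v‖ ^ 2 ≤ inner ℝ v n := by
  have hconv : Convex ℝ (closure (convexHull ℝ N)) := (convex_convexHull ℝ N).closure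
  obtain ⟨v, hv, hmin⟩ := exists_norm_eq_iInf_of_complete_convex
    (hN.convexHull (𝕜 := ℝ)).closure isClosed_closure.isComplete hconv 0
  refine ⟨v, hv, fun n hn => ?_⟩
  have hobtuse := (norm_eq_iInf_iff_real_inner_le_zero hconv hv).1 hmin n
    (subset_closure (subset_convexHull ℝ N hn))
  rw [zero_sub, inner_neg_left, inner_sub_right, real_inner_self_eq_norm_sq] at hobtuse
  linarith

theorem exists_forall_inner_pos_or_of_isCompact {N : Set E} (hN : IsCompact N) :
    (∃ v, ∀ n ∈ N, 0 < inner ℝ n v) ∨ ∀ w, ∃ n ∈ N, 0 ≤ inner ℝ n w := by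
  rcases N.eq_empty_or_nonempty with rfl | hne
  · exact Or.inl ⟨0, by simp⟩
  obtain ⟨v, hv, hmin⟩ := exists_mem_closure_convexHull_norm_sq_le_inner hne
  rcases eq_or_ne v 0 with rfl | hv0
  · refine Or.inr fun w => ?_
    obtain ⟨n, hn, hmax⟩ := hN.exists_isMaxOn hne (f := fun n => inner ℝ n w) (by fun_prop)
    have hhull : convexHull ℝ N ⊆ {k | inner ℝ k w ≤ inner ℝ n w} :=
      convexHull_min hmax <| convex_halfSpace_le (f := fun k => inner ℝ k w)
        ⟨fun x y => inner_add_left x y w, fun c x => real_inner_smul_left x w c⟩ _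
    have hzero : inner ℝ 0 w ≤ inner ℝ n w :=
      closure_minimal hhull (isClosed_le (by fun_prop) continuous_const) hv
    exact ⟨n, hn, by rwa [inner_zero_left] at hzero⟩
  · refine Or.inl ⟨v, fun n hn => ?_⟩
    rw [real_inner_comm]
    exact (pow_pos (norm_pos_iff.2 hv0) 2).trans_le (hmin n hn)

end Separation

section DistanceGradient

theorem hasFDerivAt_of_le_of_le {E : Type*} [NormedAddCommGroup E] [NormedSpace ℝ E]
    {f g h : E → ℝ} {L : StrongDual ℝ E} {x : E} (hf : HasFDerivAt f L x)
    (hh : HasFDerivAt h L x) (hfg : ∀ y, f y ≤ g y) (hgh : ∀ y, g y ≤ h y) (hx : h x = f x) :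
    HasFDerivAt g L x := by
  have hgx : g x = f x := ((hgh x).trans_eq hx).antisymm (hfg x)
  refine .of_isLittleO <| Asymptotics.IsBigO.trans_isLittleO (.of_norm_le fun y => ?_)
    (hf.isLittleO.norm_left.add hh.isLittleO.norm_left)
  simp only [hgx, hx, Real.norm_eq_abs]
  have hlow := neg_abs_le (f y - f x - L (y - x))
  have hup := le_abs_self (h y - f x - L (y - x))
  have hf_nonneg := abs_nonneg (f y - f x - L (y - x))
  have hh_nonneg := abs_nonneg (h y - f x - L (y - x))
  exact abs_le.2 ⟨by linarith [hfg y], by linarith [hgh y]⟩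

variable {E : Type*} [NormedAddCommGroup E] [InnerProductSpace ℝ E] [CompleteSpace E]

theorem hasGradientAt_dist_left {x p : E} (hxp : x ≠ p) :
    HasGradientAt (fun y => dist y p) (NormedSpace.normalize (x - p)) x := by
  have hne : ‖x - p‖ ≠ 0 := norm_ne_zero_iff.2 (sub_ne_zero.2 hxp)
  have hsqrt := ((hasFDerivAt_id x).sub_const p).norm_sq.sqrt (pow_ne_zero 2 hne)
  refine hasGradientAt_iff_hasFDerivAt.2 <|
    (hsqrt.congr_fderiv ?_).congr_of_eventuallyEq (.of_forall fun y => ?_)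
  · ext v
    simp [NormedSpace.normalize, mul_assoc]
  · simp [dist_eq_norm]

theorem hasGradientAt_infDist_lineMap {A : Set E} {z p : E} (hp : p ∈ nearestPoints A z)
    (hz : 0 < Metric.infDist z A) {s : ℝ} (hs : s ∈ Ioo (0 : ℝ) 1) :
    HasGradientAt (fun x => Metric.infDist x A) (NormedSpace.normalize (z - p))
      (AffineMap.lineMap z p s) := by
  set u : E := AffineMap.lineMap z p s with hu
  have hs1 : 0 < 1 - s := sub_pos.2 hs.2
  have hup : u - p = (1 - s) • (z - p) := by rw [hu, AffineMap.lineMap_apply_module']; module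
  have huz : u - z = s • -(z - p) := by rw [hu, AffineMap.lineMap_apply_module']; module
  have hzp : z - p ≠ 0 := norm_pos_iff.1 (norm_sub_eq_infDist hp ▸ hz)
  have hupper := hasGradientAt_dist_left (x := u) (p := p)
    (sub_ne_zero.1 (hup ▸ smul_ne_zero hs1.ne' hzp))
  have hlower := hasGradientAt_dist_left (x := u) (p := z)
    (sub_ne_zero.1 (huz ▸ smul_ne_zero hs.1.ne' (neg_ne_zero.2 hzp)))
  rw [hup, NormedSpace.normalize_smul_of_pos hs1, hasGradientAt_iff_hasFDerivAt] at hupper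
  rw [huz, NormedSpace.normalize_smul_of_pos hs.1, NormedSpace.normalize_neg,
    hasGradientAt_iff_hasFDerivAt, map_neg] at hlower
  rw [hasGradientAt_iff_hasFDerivAt]
  refine hasFDerivAt_of_le_of_le (by simpa using hlower.const_sub (Metric.infDist z A)) hupper
    (fun x => ?_) (fun x => Metric.infDist_le_dist_of_mem hp.1) ?_
  · rw [sub_le_iff_le_add, dist_comm]
    exact Metric.infDist_le_infDist_add_dist
  · rw [← hp.2, hu, dist_lineMap_right, dist_lineMap_left, Real.norm_of_nonneg hs1.le,
      Real.norm_of_nonneg hs.1.le]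
    ring

end DistanceGradient

section ClarkeGradient

variable {d : ℕ}

theorem normalize_sub_mem_clarkeGradient {A : Set (Euc d)} {z p : Euc d}
    (hp : p ∈ nearestPoints A z) (hz : 0 < Metric.infDist z A) :
    NormedSpace.normalize (z - p) ∈ clarkeGradient (distFun A) z := by
  have hgrad : ∀ k : ℕ, HasGradientAt (distFun A) (NormedSpace.normalize (z - p))
      (AffineMap.lineMap z p ((k : ℝ) + 2)⁻¹) := fun k =>
    hasGradientAt_infDist_lineMap hp hz ⟨by positivity, inv_lt_one_of_one_lt₀ (by linarith)⟩
  have hlim : Tendsto (fun k : ℕ => ((k : ℝ) + 2)⁻¹) atTop (𝓝 0) :=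
    tendsto_inv_atTop_zero.comp (tendsto_atTop_add_const_right _ _ tendsto_natCast_atTop_atTop)
  refine subset_convexHull ℝ _ ⟨_, ?_, fun k => (hgrad k).differentiableAt, ?_⟩
  · exact ((AffineMap.lineMap_continuous (p := z) (q := p)).tendsto' 0 z (by simp)).comp hlim
  · simp only [(hgrad _).gradient, tendsto_const_nhds_iff]

theorem exists_forall_mul_infDist_le_inner {A : Set (Euc d)} (hA : IsClosed A) {z : Euc d} {μ : ℝ}
    (hμ : 0 < μ) (hz : 0 < Metric.infDist z A) (h : μ ≤ minNorm (clarkeGradient (distFun A) z)) :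
    ∃ v, ‖v‖ = 1 ∧ ∀ p ∈ nearestPoints A z, μ * Metric.infDist z A ≤ inner ℝ v (z - p) := by
  obtain ⟨v, hv, hmin⟩ := exists_mem_closure_convexHull_norm_sq_le_inner
    ((nearestPoints_nonempty hA (nonempty_of_infDist_pos hz) z).image
      fun p => NormedSpace.normalize (z - p))
  have hhull : convexHull ℝ ((fun p => NormedSpace.normalize (z - p)) '' nearestPoints A z) ⊆
      clarkeGradient (distFun A) z :=
    convexHull_min (image_subset_iff.2 fun p hp => normalize_sub_mem_clarkeGradient hp hz)
      (convex_convexHull ℝ _)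
  have hvμ : μ ≤ ‖v‖ := by
    rw [minNorm, ← Metric.infDist_closure] at h
    exact dist_zero_left v ▸ h.trans (Metric.infDist_le_dist_of_mem (closure_mono hhull hv))
  have hv0 : 0 < ‖v‖ := hμ.trans_le hvμ
  refine ⟨NormedSpace.normalize v, NormedSpace.norm_normalize_eq_one_iff.2 (norm_pos_iff.1 hv0),
    fun p hp => le_of_mul_le_mul_left ?_ hv0⟩
  calc ‖v‖ * (μ * Metric.infDist z A) ≤ ‖v‖ * (‖v‖ * ‖z - p‖) := by
        rw [norm_sub_eq_infDist hp]; gcongr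
    _ = ‖z - p‖ * ‖v‖ ^ 2 := by ring
    _ ≤ ‖z - p‖ * inner ℝ v (NormedSpace.normalize (z - p)) := by
        gcongr; exact hmin _ (mem_image_of_mem _ hp)
    _ = ‖v‖ * inner ℝ (NormedSpace.normalize v) (z - p) := by
        rw [← real_inner_smul_right, ← real_inner_smul_left, NormedSpace.norm_smul_normalize,
          NormedSpace.norm_smul_normalize]

theorem exists_forall_unitNormals_inner_pos {X : Set (Euc d)} (hX : IsClosed X) {r μ s : ℝ}
    (hr : 0 < r) (hμ : 0 < μ) (hs : 0 < s)
    (hΔ : ∀ z, 0 < Metric.infDist z X → Metric.infDist z X ≤ s →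
      μ ≤ minNorm (clarkeGradient (distFun X) z))
    {x : Euc d} (hx : x ∈ X) (hxC : x ∈ complementSet X) :
    ∃ v, ∀ n ∈ unitNormals (complementSet X) r x, 0 < inner ℝ n v := by
  refine (exists_forall_inner_pos_or_of_isCompact
    (isCompact_unitNormals isClosed_closure r x)).resolve_right fun hall => ?_
  -- Climbing `d_X` from a point near `x` reaches a `z` with `μ * t ≤ d_X z` and `‖z - x‖ ≤ 2 * t`.
  -- A unit normal `n` with `0 ≤ ⟪n, z - x⟫` forces `d_X z = O(t ^ 2)`: impossible for small `t`.
  obtain ⟨t, ht0, hts, htr⟩ : ∃ t, 0 < t ∧ 2 * t ≤ s ∧ 2 * t ≤ r * μ :=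
    ⟨min (s / 2) (r * μ / 2), by positivity, by linarith [min_le_left (s / 2) (r * μ / 2)],
      by linarith [min_le_right (s / 2) (r * μ / 2)]⟩
  obtain ⟨y, hyX, hxy⟩ := Metric.mem_closure_iff.1 hxC t ht0
  have hy : 0 < Metric.infDist y X := (hX.notMem_iff_infDist_pos ⟨x, hx⟩).1 hyX
  have hzx : ∀ z, dist z y ≤ t → dist z x ≤ 2 * t := fun z hz => by
    linarith [dist_triangle_right z x y]
  obtain ⟨z, hzy, hz⟩ := exists_dist_eq_add_mul_le_infDist hX ht0.le hμ hy fun z hzy hz =>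
    exists_forall_mul_infDist_le_inner hX hμ hz <| hΔ z hz <|
      (Metric.infDist_le_dist_of_mem hx).trans ((hzx z hzy.le).trans hts)
  obtain ⟨n, hn, hnz⟩ := hall (z - x)
  have hquad := two_mul_infDist_le_of_mem_unitNormals_closure_compl hr hn hnz
  have hsq : ‖z - x‖ ^ 2 ≤ (2 * t) ^ 2 := by
    gcongr
    exact dist_eq_norm z x ▸ hzx z hzy.le
  have hlin : 2 * r * (μ * t) < 2 * r * Metric.infDist z X := by gcongr; linarith
  nlinarith [mul_le_mul_of_nonneg_right htr ht0.le]

end ClarkeGradient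

section VectorField

variable {E : Type*} [NormedAddCommGroup E] [InnerProductSpace ℝ E] {N : E → Set E} {g : E → E}

theorem exists_eventually_inner_nonneg_and_inner_le_neg_one (hN : UpperHemicontinuous N)
    (hg : Continuous g) {x v : E} (hv : ∀ n ∈ N x, 0 < inner ℝ n v) (hgv : inner ℝ (g x) v < 0) :
    ∃ c, ∀ᶠ y in 𝓝 x, (∀ n ∈ N y, 0 ≤ inner ℝ n c) ∧ inner ℝ (g y) c ≤ -1 := by
  obtain ⟨k, hk0, hk⟩ : ∃ k : ℝ, 0 < k ∧ k * inner ℝ (g x) v < -1 :=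
    ⟨-2 / inner ℝ (g x) v, div_pos_of_neg_of_neg (by norm_num) hgv, by
      rw [div_mul_cancel₀ _ hgv.ne]; norm_num⟩
  have hcone : ∀ᶠ y in 𝓝 x, {n : E | 0 < inner ℝ n v} ∈ 𝓝ˢ (N y) :=
    upperHemicontinuousAt_iff.1 (hN.upperHemicontinuousAt x) _
      ((isOpen_lt continuous_const (by fun_prop)).mem_nhdsSet.2 hv)
  have hdecr : ∀ᶠ y in 𝓝 x, k * inner ℝ (g y) v < -1 :=
    (Continuous.tendsto (by fun_prop) x).eventually_lt_const hk
  refine ⟨k • v, ?_⟩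
  filter_upwards [hcone, hdecr] with y hy hgy
  refine ⟨fun n hn => ?_, by rw [inner_smul_right]; exact hgy.le⟩
  have hnv : 0 < inner ℝ n v := subset_of_mem_nhdsSet hy hn
  rw [inner_smul_right]
  positivity

open scoped Manifold ContDiff in
theorem exists_vectorField_of_forall_exists [FiniteDimensional ℝ E] (hN : UpperHemicontinuous N)
    (hg : Continuous g) {M : Set E} (hM : IsCompact M)
    (hv : ∀ x ∈ M, ∃ v, (∀ n ∈ N x, 0 < inner ℝ n v) ∧ inner ℝ (g x) v < 0) :
    ∃ w : E → E, ContDiff ℝ 1 w ∧ HasCompactSupport w ∧ (∀ x, ∀ n ∈ N x, 0 ≤ inner ℝ n (w x)) ∧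
      (∀ x, inner ℝ (g x) (w x) ≤ 0) ∧ ∀ x ∈ M, inner ℝ (g x) (w x) ≤ -1 := by
  obtain ⟨K, hK, hMK⟩ := exists_compact_superset hM
  -- All the requirements are convex, so local solutions glue by a partition of unity.
  let t : E → Set E := fun x => {v | (∀ n ∈ N x, 0 ≤ inner ℝ n v) ∧
    inner ℝ (g x) v ≤ 0 ∧ (x ∈ M → inner ℝ (g x) v ≤ -1) ∧ (x ∉ K → v = 0)}
  have ht : ∀ x, Convex ℝ (t x) := by
    rintro x u ⟨hu_cone, hu_nonpos, hu_le, hu_zero⟩ v ⟨hv_cone, hv_nonpos, hv_le, hv_zero⟩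
      α β hα hβ hαβ
    refine ⟨fun n hn => ?_, ?_, fun hx => ?_, fun hx => by simp [hu_zero hx, hv_zero hx]⟩ <;>
      rw [inner_add_right, inner_smul_right, inner_smul_right]
    · have := hu_cone n hn
      have := hv_cone n hn
      positivity
    · nlinarith
    · nlinarith [hu_le hx, hv_le hx]
  have hloc : ∀ x, ∃ c : E, ∀ᶠ y in 𝓝 x, c ∈ t y := by
    intro x
    by_cases hx : x ∈ M
    · obtain ⟨v, hvN, hvg⟩ := hv x hx
      obtain ⟨c, hc⟩ := exists_eventually_inner_nonneg_and_inner_le_neg_one hN hg hvN hvg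
      refine ⟨c, ?_⟩
      filter_upwards [hc, isOpen_interior.mem_nhds (hMK hx)] with y ⟨hcN, hcg⟩ hy
      exact ⟨hcN, by linarith, fun _ => hcg, fun hyK => absurd (interior_subset hy) hyK⟩
    · refine ⟨0, ?_⟩
      filter_upwards [hM.isClosed.isOpen_compl.mem_nhds hx] with y hy
      exact ⟨by simp, by simp, fun h => absurd h hy, fun _ => rfl⟩
  obtain ⟨w, hw⟩ := exists_contMDiffMap_forall_mem_convex_of_local_const (n := 1) 𝓘(ℝ, E) ht hloc
  exact ⟨w, w.contMDiff.contDiff, HasCompactSupport.intro hK fun x => (hw x).2.2.2,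
    fun x => (hw x).1, fun x => (hw x).2.1, fun x => (hw x).2.2.1⟩

end VectorField

section Flow

theorem exists_flow_of_lipschitzWith {E : Type*} [NormedAddCommGroup E] [NormedSpace ℝ E]
    [CompleteSpace E] {w : E → E} {K : NNReal} (hw : LipschitzWith K w) {B : ℝ}
    (hB : ∀ x, ‖w x‖ ≤ B) {T : ℝ} (hT : 0 ≤ T) :
    ∃ φ : E × ℝ → E, ContinuousOn φ (univ ×ˢ Icc 0 T) ∧ ∀ x, φ (x, 0) = x ∧
      ∀ t ∈ Icc 0 T, HasDerivWithinAt (fun t => φ (x, t)) (w (φ (x, t))) (Icc 0 T) t := by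
  have hex : ∀ x, ∃ γ : ℝ → E, γ 0 = x ∧
      ∀ t ∈ Icc 0 T, HasDerivWithinAt γ (w (γ t)) (Icc 0 T) t := fun x => by
    have hPL : IsPicardLindelof (fun _ => w) (⟨0, le_rfl, hT⟩ : Icc 0 T) x
        (B.toNNReal * T.toNNReal) 0 B.toNNReal K :=
      .of_time_independent (fun y _ => (hB y).trans (Real.le_coe_toNNReal B)) hw.lipschitzOnWith
        (by simp [hT])
    exact hPL.exists_eq_forall_mem_Icc_hasDerivWithinAt₀
  choose γ hγ0 hγ using hex
  have hcont : ∀ x, ContinuousOn (γ x) (Icc 0 T) :=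
    fun x t ht => (hγ x t ht).continuousWithinAt
  have hder : ∀ x, ∀ t ∈ Ico 0 T, HasDerivWithinAt (γ x) (w (γ x t)) (Ici t) t :=
    fun x t ht => (hγ x t (Ico_subset_Icc_self ht)).mono_of_mem_nhdsWithin
      (Icc_mem_nhdsGE_of_mem ht)
  have hlip : ∀ t ∈ Icc 0 T, LipschitzOnWith (Real.exp (K * T)).toNNReal (fun x => γ x t) univ := by
    refine fun t ht => .of_dist_le_mul fun x _ y _ => ?_
    rw [Real.coe_toNNReal _ (Real.exp_pos _).le, mul_comm]
    calc dist (γ x t) (γ y t) ≤ dist x y * Real.exp (K * (t - 0)) :=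
          dist_le_of_trajectories_ODE (fun _ => hw) (hcont x) (hder x) (hcont y) (hder y)
            (by rw [hγ0, hγ0]) t ht
      _ ≤ dist x y * Real.exp (K * T) := by rw [sub_zero]; gcongr; exact ht.2
  exact ⟨fun q => γ q.1 q.2, continuousOn_prod_of_continuousOn_lipschitzOnWith _ _
    (fun x _ => hcont x) hlip, fun x => ⟨hγ0 x, hγ x⟩⟩

variable {E : Type*} [NormedAddCommGroup E] [InnerProductSpace ℝ E] {X : Set E}

theorem eventually_slope_infDist_sq_lt {γ : ℝ → E} {γ' p : E} {t ρ : ℝ}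
    (hp : p ∈ nearestPoints X (γ t)) (hγ : HasDerivWithinAt γ γ' (Ioi t) t)
    (hρ : 2 * inner ℝ (γ t - p) γ' < ρ) : ∀ᶠ z in 𝓝[>] t,
      (z - t)⁻¹ * (Metric.infDist (γ z) X ^ 2 - Metric.infDist (γ t) X ^ 2) < ρ := by
  filter_upwards [(hγ.sub_const p).norm_sq.limsup_slope_le' (notMem_Ioi.2 le_rfl) hρ,
    self_mem_nhdsWithin] with z hz hzt
  refine lt_of_le_of_lt ?_ hz
  have hzt_pos : 0 < z - t := sub_pos.2 hzt
  have hle : Metric.infDist (γ z) X ≤ ‖γ z - p‖ :=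
    dist_eq_norm (γ z) p ▸ Metric.infDist_le_dist_of_mem hp.1
  have hnonneg : 0 ≤ Metric.infDist (γ z) X := Metric.infDist_nonneg
  rw [slope_def_field, div_eq_inv_mul, norm_sub_eq_infDist hp]
  gcongr

theorem mem_of_hasDerivWithinAt_of_inner_nonpos [ProperSpace E] (hX : IsClosed X)
    {w : E → E} {K : NNReal} (hw : LipschitzWith K w)
    (hin : ∀ y, ∀ p ∈ nearestPoints X y, inner ℝ (w p) (y - p) ≤ 0)
    {γ : ℝ → E} {T : ℝ} (hγ : ∀ t ∈ Icc 0 T, HasDerivWithinAt γ (w (γ t)) (Icc 0 T) t)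
    (h0 : γ 0 ∈ X) : ∀ t ∈ Icc 0 T, γ t ∈ X := by
  have hne : X.Nonempty := ⟨_, h0⟩
  -- Grönwall's inequality for the squared distance to `X`, whose right derivative along `γ` is at
  -- most `2 * K` times itself.
  have hbound : ∀ t ∈ Icc 0 T, Metric.infDist (γ t) X ^ 2 ≤ gronwallBound 0 (2 * K) 0 (t - 0) := by
    refine le_gronwallBound_of_liminf_deriv_right_le
      (f' := fun t => 2 * K * Metric.infDist (γ t) X ^ 2)
      (((Metric.continuous_infDist_pt X).comp_continuousOn
        fun t ht => (hγ t ht).continuousWithinAt).pow 2)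
      (fun t ht ρ hρ => ?_) (by simp [Metric.infDist_zero_of_mem h0]) (fun t _ => by simp)
    obtain ⟨p, hp⟩ := nearestPoints_nonempty hX hne (γ t)
    have hright : HasDerivWithinAt γ (w (γ t)) (Ioi t) t :=
      (hγ t (Ico_subset_Icc_self ht)).mono_of_mem_nhdsWithin (Icc_mem_nhdsGT_of_mem ht)
    refine (eventually_slope_infDist_sq_lt hp hright (lt_of_le_of_lt ?_ hρ)).frequently
    have hlip : inner ℝ (γ t - p) (w (γ t) - w p) ≤ ‖γ t - p‖ * (K * ‖γ t - p‖) :=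
      (real_inner_le_norm _ _).trans (by gcongr; exact hw.norm_sub_le _ _)
    rw [inner_sub_right, real_inner_comm (w p)] at hlip
    rw [← norm_sub_eq_infDist hp]
    linarith [hin (γ t) p hp]
  refine fun t ht => (hX.mem_iff_infDist_zero hne).2 (pow_eq_zero_iff two_ne_zero |>.1 ?_)
  have h := hbound t ht
  rw [gronwallBound_ε0, zero_mul] at h
  exact h.antisymm (sq_nonneg _)

end Flow

section DeformationRetract

theorem isDeformationRetract_of_continuousOn {Y : Type*} [TopologicalSpace Y] {A B : Set Y}
    (hAB : A ⊆ B) {T : ℝ} {φ : Y × ℝ → Y} (hφ : ContinuousOn φ (B ×ˢ Icc 0 T))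
    (hφ0 : ∀ x ∈ B, φ (x, 0) = x) (hφB : ∀ x ∈ B, ∀ t ∈ Icc 0 T, φ (x, t) ∈ B) {τ : Y → ℝ}
    (hτ : ContinuousOn τ B) (hτT : ∀ x ∈ B, τ x ∈ Icc 0 T) (hτA : ∀ x ∈ A, τ x = 0)
    (hend : ∀ x ∈ B, φ (x, τ x) ∈ A) : IsDeformationRetract A B := by
  have hmem : ∀ (s : I) (x : B), (s : ℝ) * τ x ∈ Icc 0 T := fun s x =>
    have ⟨h0, hT⟩ := hτT x x.2
    ⟨mul_nonneg s.2.1 h0, (mul_le_of_le_one_left h0 s.2.2).trans hT⟩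
  have hτ_snd : Continuous fun q : I × B => τ q.2 :=
    hτ.comp_continuous (by fun_prop) fun q => q.2.2
  have hcont : Continuous fun q : I × B => φ (q.2, q.1 * τ q.2) :=
    hφ.comp_continuous (.prodMk (by fun_prop) (.mul (by fun_prop) hτ_snd))
      fun q => ⟨q.2.2, hmem q.1 q.2⟩
  let H : C(I × B, B) := ⟨fun q => ⟨φ (q.2, q.1 * τ q.2), hφB _ q.2.2 _ (hmem q.1 q.2)⟩,
    hcont.subtype_mk _⟩
  refine ⟨hAB, H.comp ((ContinuousMap.const B 1).prodMk (ContinuousMap.id B)),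
    fun x => ?_, ⟨⟨⟨H, fun x => Subtype.ext ?_, fun x => rfl⟩, fun s x hx => Subtype.ext ?_⟩⟩⟩
  · simpa [H] using hend x x.2
  · simp [H, hφ0 x x.2]
  · simp [H, hτA x hx, hφ0 x x.2]

theorem le_of_deriv_le_neg_one_of_antitoneOn {h h' : ℝ → ℝ} {a T : ℝ}
    (hh : ∀ t ∈ Icc 0 T, HasDerivWithinAt h (h' t) (Icc 0 T) t) (hanti : AntitoneOn h (Icc 0 T))
    (hT : h 0 - a ≤ T) (hT0 : 0 ≤ T) (hslope : ∀ t ∈ Icc 0 T, a ≤ h t → h' t ≤ -1) :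
    h (max (h 0 - a) 0) ≤ a := by
  set τ := max (h 0 - a) 0
  have hτ : τ ∈ Icc 0 T := ⟨le_max_right _ _, max_le hT hT0⟩
  by_contra! hlt
  have hsub : Icc 0 τ ⊆ Icc 0 T := Icc_subset_Icc_right hτ.2
  have hmvt : h τ ≤ h 0 - τ := by
    refine image_le_of_deriv_right_le_deriv_boundary (B := fun t => h 0 - t) (B' := fun _ => -1)
      (fun t ht => ((hh t (hsub ht)).mono hsub).continuousWithinAt)
      (fun t ht => (hh t (hsub (Ico_subset_Icc_self ht))).mono_of_mem_nhdsWithin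
        (Icc_mem_nhdsGE_of_mem ⟨ht.1, ht.2.trans_le hτ.2⟩))
      (by simp) (by fun_prop)
      (fun t _ => ((hasDerivAt_id t).const_sub (h 0)).hasDerivWithinAt)
      (fun t ht => hslope t (hsub (Ico_subset_Icc_self ht))
        (hlt.le.trans (hanti (hsub (Ico_subset_Icc_self ht)) hτ ht.2.le)))
      (right_mem_Icc.2 hτ.1)
  linarith [le_max_left (h 0 - a) 0]

theorem isDeformationRetract_sublevelOn_of_flow {d : ℕ} {X : Set (Euc d)} {f : Euc d → ℝ}
    (hf : Differentiable ℝ f) {a b : ℝ} (hab : a ≤ b) {w : Euc d → Euc d} {φ : Euc d × ℝ → Euc d}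
    (hφc : ContinuousOn φ (X ×ˢ Icc 0 (b - a))) (hφ0 : ∀ x ∈ X, φ (x, 0) = x)
    (hφX : ∀ x ∈ X, ∀ t ∈ Icc 0 (b - a), φ (x, t) ∈ X)
    (hφ : ∀ x ∈ X, ∀ t ∈ Icc 0 (b - a),
      HasDerivWithinAt (fun t => φ (x, t)) (w (φ (x, t))) (Icc 0 (b - a)) t)
    (hw : ∀ x ∈ X, inner ℝ (gradient f x) (w x) ≤ 0)
    (hw1 : ∀ x ∈ X ∩ f ⁻¹' Icc a b, inner ℝ (gradient f x) (w x) ≤ -1) :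
    IsDeformationRetract (sublevelOn f X a) (sublevelOn f X b) := by
  have h0 : (0 : ℝ) ∈ Icc 0 (b - a) := left_mem_Icc.2 (sub_nonneg.2 hab)
  have hder : ∀ x ∈ X, ∀ t ∈ Icc 0 (b - a), HasDerivWithinAt (fun t => f (φ (x, t)))
      (inner ℝ (gradient f (φ (x, t))) (w (φ (x, t)))) (Icc 0 (b - a)) t := fun x hx t ht => by
    have hchain := (hf (φ (x, t))).hasGradientAt.hasFDerivAt.comp_hasDerivWithinAt t (hφ x hx t ht)
    rwa [InnerProductSpace.toDual_apply_apply] at hchain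
  have hanti : ∀ x ∈ X, AntitoneOn (fun t => f (φ (x, t))) (Icc 0 (b - a)) := fun x hx =>
    antitoneOn_of_hasDerivWithinAt_nonpos (convex_Icc _ _)
      (fun t ht => (hder x hx t ht).continuousWithinAt)
      (fun t ht => (hder x hx t (interior_subset ht)).mono interior_subset)
      fun t ht => hw _ (hφX x hx t (interior_subset ht))
  have hle : ∀ x ∈ X, ∀ t ∈ Icc 0 (b - a), f (φ (x, t)) ≤ f x := fun x hx t ht => by
    simpa only [hφ0 x hx] using hanti x hx h0 ht ht.1
  have hmaps : ∀ x ∈ sublevelOn f X b, ∀ t ∈ Icc 0 (b - a), φ (x, t) ∈ sublevelOn f X b :=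
    fun x hx t ht => ⟨hφX x hx.1 t ht, (hle x hx.1 t ht).trans hx.2⟩
  have hτ : ∀ x ∈ sublevelOn f X b, max (f x - a) 0 ∈ Icc 0 (b - a) := fun x hx =>
    ⟨le_max_right _ _, max_le (sub_le_sub_right hx.2 a) h0.2⟩
  refine isDeformationRetract_of_continuousOn (τ := fun x => max (f x - a) 0)
    (fun x hx => ⟨hx.1, le_trans (mem_Iic.1 hx.2) hab⟩)
    (hφc.mono (prod_mono inter_subset_left Subset.rfl)) (fun x hx => hφ0 x hx.1) hmaps
    (by have := hf.continuous; fun_prop) hτ (fun x hx => max_eq_right (sub_nonpos.2 hx.2))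
    fun x hx => ⟨hφX x hx.1 _ (hτ x hx), ?_⟩
  have hend := le_of_deriv_le_neg_one_of_antitoneOn (a := a) (hder x hx.1) (hanti x hx.1)
    (by simpa only [hφ0 x hx.1] using sub_le_sub_right hx.2 a) h0.2 fun t ht hat =>
      hw1 _ ⟨hφX x hx.1 t ht, hat, (hle x hx.1 t ht).trans hx.2⟩
  simpa only [hφ0 x hx.1, mem_preimage, mem_Iic] using hend

end DeformationRetract

section ComplementaryRegular

variable {d : ℕ} {X : Set (Euc d)} {r : ℝ}

theorem inner_nonpos_of_mem_tanCone {C : Set (Euc d)} (hr : 0 < r) {x n v : Euc d}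
    (hn : n ∈ unitNormals C r x) (hv : v ∈ tanCone C x) : inner ℝ n v ≤ 0 := by
  obtain ⟨l, w, hl, rfl, u, hu, hux, huw⟩ := hv
  have hinner : Tendsto (fun k => inner ℝ n (‖u k - x‖⁻¹ • (u k - x))) atTop (𝓝 (inner ℝ n w)) :=
    tendsto_const_nhds.inner huw
  have hbound : Tendsto (fun k => ‖u k - x‖ / (2 * r)) atTop (𝓝 0) := by
    simpa using (tendsto_iff_norm_sub_tendsto_zero.1 hux).div_const (2 * r)
  rw [inner_smul_right]
  refine mul_nonpos_of_nonneg_of_nonpos hl (le_of_tendsto_of_tendsto' hinner hbound fun k => ?_)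
  have hpos : 0 < ‖u k - x‖ := norm_pos_iff.2 (sub_ne_zero.2 (hu k).2)
  rw [inner_smul_right, inv_mul_le_iff₀ hpos, mul_div_assoc', le_div_iff₀ (by positivity)]
  linarith [two_mul_inner_le_of_mem_unitNormals hr.le hn (hu k).1]

theorem exists_hasReachAtLeast_of_reach_pos {A : Set (Euc d)} (hA : 0 < reach A) :
    ∃ r, 0 < r ∧ HasReachAtLeast A r := by
  obtain ⟨t, ht, ht0⟩ := lt_sSup_iff.1 hA
  obtain ⟨r, hr0, hrt⟩ := ENNReal.lt_iff_exists_nnreal_btwn.1 ht0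
  refine ⟨r, by exact_mod_cast hr0, fun z hz p ⟨hp, hzp⟩ q ⟨hq, hzq⟩ => ?_⟩
  have hedist : Metric.infEDist z A = ENNReal.ofReal (Metric.infDist z A) :=
    (ENNReal.ofReal_toReal (Metric.infEDist_ne_top ⟨p, hp⟩)).symm
  refine (ht z ?_).unique ⟨hp, ?_⟩ ⟨hq, ?_⟩
  · rw [hedist]
    exact ((ENNReal.ofReal_lt_coe_iff Metric.infDist_nonneg).2 hz).trans hrt
  · rw [edist_dist, hzp, hedist]
  · rw [edist_dist, hzq, hedist]

theorem exists_forall_le_minNorm_of_muReach_pos {μ : ℝ} (h : 0 < muReach μ X) :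
    ∃ s : ℝ, 0 < s ∧ ∀ z, 0 < Metric.infDist z X → Metric.infDist z X ≤ s →
      μ ≤ minNorm (clarkeGradient (distFun X) z) := by
  obtain ⟨t, ht, ht0⟩ := lt_sSup_iff.1 h
  obtain ⟨s, hs0, hst⟩ := ENNReal.lt_iff_exists_nnreal_btwn.1 ht0
  refine ⟨s, by exact_mod_cast hs0, fun z hz hzs => ht z ?_ (le_trans ?_ hst.le)⟩
  · exact (ENNReal.toReal_pos_iff.1 hz).1
  · rw [← ENNReal.ofReal_toReal (Metric.infEDist_ne_top (nonempty_of_infDist_pos hz))]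
    exact ENNReal.ofReal_le_of_le_toReal hzs

theorem mem_frontier_iff_mem_complementSet {x : Euc d} (hx : x ∈ X) :
    x ∈ frontier X ↔ x ∈ complementSet X := by
  rw [frontier_eq_closure_inter_closure]
  exact and_iff_right (subset_closure hx)

theorem closure_compl_complementSet (X : Set (Euc d)) :
    closure (complementSet X)ᶜ = closure (interior X) := by
  rw [complementSet, interior_eq_compl_closure_compl]

theorem inner_nonpos_of_forall_unitNormals (hX : closure (interior X) = X) (hr : 0 < r)
    (hreach : HasReachAtLeast (complementSet X) r) {y p v : Euc d} (hp : p ∈ nearestPoints X y)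
    (hv : ∀ n ∈ unitNormals (complementSet X) r p, 0 ≤ inner ℝ n v) :
    inner ℝ v (y - p) ≤ 0 := by
  rcases (Metric.infDist_nonneg (x := y) (s := X)).eq_or_lt with h0 | hpos
  · rw [← norm_sub_eq_infDist hp, eq_comm, norm_eq_zero] at h0
    rw [h0, inner_zero_right]
  set ρ := Metric.infDist y X
  set ν := NormedSpace.normalize (y - p)
  have hyp : ‖y - p‖ = ρ := norm_sub_eq_infDist hp
  have hρν : ρ • ν = y - p := hyp ▸ NormedSpace.norm_smul_normalize (y - p)
  have hν : ‖ν‖ = 1 := NormedSpace.norm_normalize_eq_one_iff.2 (norm_pos_iff.1 (hyp ▸ hpos))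
  have hball : Metric.closedBall y ρ ⊆ complementSet X := by
    rw [← closure_ball y hpos.ne']
    exact closure_mono Metric.disjoint_ball_infDist.subset_compl_right
  have hpC : p ∈ complementSet X := hball (Metric.mem_closedBall'.2 hp.2.le)
  obtain ⟨n, hn⟩ := unitNormals_nonempty isClosed_closure hr hreach hpC
    (((closure_compl_complementSet X).trans hX).symm.subset hp.1)
  have hnν : n = -ν := eq_neg_of_mem_unitNormals_of_closedBall_subset hr hpos hν hn
    (by rwa [hρν, add_sub_cancel])
  have hinner : 0 ≤ -inner ℝ ν v := by simpa [hnν] using hv n hn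
  rw [← hρν, inner_smul_right, real_inner_comm]
  exact mul_nonpos_of_nonneg_of_nonpos hpos.le (by linarith)

theorem exists_inner_pos_and_inner_gradient_neg (hr : 0 < r) {f : Euc d → ℝ} {x : Euc d}
    (hx : x ∈ X) (hpointed : x ∈ complementSet X →
      ∃ v, ∀ n ∈ unitNormals (complementSet X) r x, 0 < inner ℝ n v)
    (hreg : ¬ IsCriticalPointOn f X x) :
    ∃ v, (∀ n ∈ unitNormals (complementSet X) r x, 0 < inner ℝ n v) ∧
      inner ℝ (gradient f x) v < 0 := by
  have hfr := mem_frontier_iff_mem_complementSet hx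
  by_cases hxC : x ∈ complementSet X
  · obtain ⟨u, hu, hgu⟩ : ∃ u ∈ tanCone (complementSet X) x, 0 < inner ℝ (gradient f x) u := by
      by_contra! hpolar
      exact hreg ⟨hx, fun _ => by rwa [neg_neg], fun h => absurd (hfr.2 hxC) h⟩
    obtain ⟨v, hv⟩ := hpointed hxC
    -- `-u` is weakly inward and decreases `f`; a small multiple of `v` makes it strictly inward.
    have hsmall : ∀ᶠ ε in 𝓝[>] (0 : ℝ), inner ℝ (gradient f x) (ε • v - u) < 0 :=
      ((Continuous.tendsto (by fun_prop) 0).eventually_lt_const (by simpa using hgu)).filter_mono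
        nhdsWithin_le_nhds
    obtain ⟨ε, hε, hε0⟩ := (hsmall.and self_mem_nhdsWithin).exists
    refine ⟨ε • v - u, fun n hn => ?_, hε⟩
    rw [inner_sub_right, inner_smul_right]
    linarith [inner_nonpos_of_mem_tanCone hr hn hu, mul_pos (mem_Ioi.1 hε0) (hv n hn)]
  · have hgrad : gradient f x ≠ 0 := fun h =>
      hreg ⟨hx, fun hx' => absurd (hfr.1 hx') hxC, fun _ => by rw [h, neg_zero]⟩
    refine ⟨-gradient f x, fun n hn => absurd hn.1 hxC, ?_⟩
    rw [inner_neg_right, neg_lt_zero]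
    exact real_inner_self_pos.2 hgrad

end ComplementaryRegular

theorem mainTheorem4_general {d : ℕ} {X : Set (Euc d)} (hint : closure (interior X) = X) {μ : ℝ}
    (hμ : 0 < μ) (hμX : 0 < muReach μ X) (hreach : 0 < reach (complementSet X)) {f : Euc d → ℝ}
    (hf : ContDiff ℝ 1 f) {a b : ℝ} (hab : a ≤ b) (hcompact : IsCompact (X ∩ f ⁻¹' Icc a b))
    (hreg : ∀ c ∈ Icc a b, IsRegularValueOn f X c) :
    IsDeformationRetract (sublevelOn f X a) (sublevelOn f X b) := by
  have hX : IsClosed X := hint ▸ isClosed_closure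
  obtain ⟨r, hr, hCr⟩ := exists_hasReachAtLeast_of_reach_pos hreach
  obtain ⟨s, hs, hΔ⟩ := exists_forall_le_minNorm_of_muReach_pos hμX
  have hgrad : Continuous (gradient f) :=
    (InnerProductSpace.toDual ℝ (Euc d)).symm.continuous.comp (hf.continuous_fderiv one_ne_zero)
  obtain ⟨w, hw, hwc, hwn, hw0, hw1⟩ := exists_vectorField_of_forall_exists
    (upperHemicontinuous_unitNormals isClosed_closure r) hgrad hcompact fun x hx =>
      exists_inner_pos_and_inner_gradient_neg hr hx.1
        (exists_forall_unitNormals_inner_pos hX hr hμ hs hΔ hx.1)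
        fun hcrit => hreg (f x) hx.2 ⟨x, hcrit, rfl⟩
  obtain ⟨K, hK⟩ := hw.lipschitzWith_of_hasCompactSupport hwc one_ne_zero
  obtain ⟨B, hB⟩ := hwc.exists_bound_of_continuous hw.continuous
  obtain ⟨φ, hφc, hφ⟩ := exists_flow_of_lipschitzWith hK hB (sub_nonneg.2 hab)
  exact isDeformationRetract_sublevelOn_of_flow (hf.differentiable one_ne_zero) hab
    (hφc.mono (prod_mono (subset_univ X) Subset.rfl)) (fun x _ => (hφ x).1)
    (fun x hx => mem_of_hasDerivWithinAt_of_inner_nonpos hX hK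
      (fun y p hp => inner_nonpos_of_forall_unitNormals hint hr hCr hp (hwn p)) (hφ x).2
      ((hφ x).1.symm ▸ hx))
    (fun x _ => (hφ x).2) (fun x _ => hw0 x) hw1

theorem mainTheorem4 (d : ℕ) (X : Set (Euc d)) (hX : IsComplementaryRegular X)
    (f : Euc d → ℝ) (hf : ContDiff ℝ 2 f) (a b : ℝ) (hab : a < b)
    (hreg : ∀ c ∈ Icc a b, IsRegularValueOn f X c) :
    IsDeformationRetract (sublevelOn f X a) (sublevelOn f X b) :=
  have ⟨_, hμ, _, hμX⟩ := hX.muReach_pos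
  mainTheorem4_general hX.closure_interior hμ hμX hX.reach_complementSet_pos
    (hf.of_le one_le_two) hab.le
    (hX.isCompact.inter_right (isClosed_Icc.preimage hf.continuous)) hreg
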